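/- Consider a game $(A,u^1,u^2)$ in which two players alternately choose actions from a nonempty set $A$, player 1 at odd stages and player 2 at even stages, each knowing all earlier actions. The payoff functions $u^1,u^2:A^{\mathbb N}\to\mathbb R$ have finite range. A finite history is a finite sequence $h$ of actions, $(h,a)$ is $h$ followed by the action $a$, and $i(h)$ is the player who moves after $h$ ($i(h)=1$ if $h$ has even length, $i(h)=2$ otherwise); $-i$ is the player other than $i$. A strategy of player $i$ assigns an action to every finite history at which $i$ moves, and $u^i(\sigma^1,\sigma^2\mid h)$ is the payoff to $i$ of the play that starts with $h$ and continues according to $\sigma^1,\sigma^2$. For a function $\alpha$ from finite histories to $\mathbb R$, a play $p$ is called $\alpha$-viable at $h$ if $h$ is a prefix of $p$ and $u^{i(h')}(p)\ge\alpha(h')$ for every prefix $h'$ of $p$ that extends (or equals) $h$. It is called $\alpha$-monotonic at $h$ if $h$ is a prefix of $p$ and, writing $h_n$ for the prefix of $p$ of length $n$, the two sequences $(\alpha(h_{2k}))_{k:\,h\preceq h_{2k}}$ and $(\alpha(h_{2k+1}))_{k:\,h\preceq h_{2k+1}}$ are non-decreasing, where $h\preceq h'$ means that $h$ is a prefix of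 $h'$. For every ordinal $\xi\ge1$ and every finite history $h$ define $\alpha_\xi(h)\in\mathbb R$ and a set $H_\xi(h)$ of plays by transfinite recursion: $$\alpha_1(h)=\max_{\sigma^{i(h)}}\min_{\sigma^{-i(h)}}u^{i(h)}(\sigma^1,\sigma^2\mid h),\qquad H_1(h)=\{p: p\text{ is }\alpha_1\text{-viable at }h\};$$ $$\alpha_{\xi+1}(h)=\max_{a\in A}\ \min_{p\in H_\xi(h,a)}u^{i(h)}(p),\qquad H_{\xi+1}(h)=\Big\{p\in\bigcup_{a\in A}H_\xi(h,a): u^{i(h)}(p)\ge\alpha_{\xi+1}(h)\Big\};$$ and, for every limit ordinal $\xi$, $$\alpha_\xi(h)=\max_{1\le\lambda<\xi}\alpha_\lambda(h),\qquad H_\xi(h)=\{p: p\text{ is }\alpha_\xi\text{-viable at }h\}.$$ Then all maxima and minima in the recursion for $\alpha_{\xi+1}$ and $\alpha_\xi$ ($\xi$ limit) are attained. If $u^1,u^2$ are moreover lower semicontinuous ($A$ discrete, $A^{\mathbb N}$ with the product topology), then $\alpha_1(h)$ is the value at $h$, that is, it is equal to $\min_{\sigma^{-i(h)}}\max_{\sigma^{i(h)}}u^{i(h)}(\sigma^1,\sigma^2\mid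 h)$ as well. Furthermore, for every finite history $h$: 1. $H_\xi(h)\neq\emptyset$ for every ordinal $\xi\ge1$. 2. $H_\eta(h)\subseteq H_\xi(h)$ for all ordinals $1\le\xi\le\eta$. 3. $\alpha_\xi(h)\le\alpha_\eta(h)$ for all ordinals $1\le\xi\le\eta$. 4. For $\xi=1$ and for every limit ordinal $\xi$ there is a play $p\in H_\xi(h)$ that is $\alpha_\xi$-monotonic at $h$. -/

import Mathlib

/-! Two-player games of infinite duration with perfect information.

`A` is the set of actions, a finite history is a list of actions, a play is a sequence `ℕ → A`
(the action of stage `t` is entry `t - 1`), and the payoffs are `u : Fin 2 → (ℕ → A) → ℝ`, where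
the index `0` is the first player (who moves after histories of even length) and the index `1` is
the second player (who moves after histories of odd length). -/

universe w

namespace BorelGame

/-- The player who has to choose an action after the history `h`. -/
def mover {A : Type*} (h : List A) : Fin 2 := if Even h.length then 0 else 1

/-- The player who is not `i`. -/
def opponent (i : Fin 2) : Fin 2 := 1 - i

theorem eq_opponent_of_ne {i j : Fin 2} (hij : j ≠ i) : j = opponent i := by
  revert i j; decide

/-- The prefix of length `n` of the play `p`. -/
def initial {A : Type*} (p : ℕ → A) (n : ℕ) : List A := (List.range n).map p

/-- The history `h` is a prefix of the play `p`. -/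
def IsPrefixOf {A : Type*} (h : List A) (p : ℕ → A) : Prop := initial p h.length = h

/-- A strategy of player `i` chooses an action after every history at which `i` moves. -/
abbrev Strategy (A : Type*) (i : Fin 2) : Type _ := {h : List A // mover h = i} → A

/-- The action chosen after the history `g` if player `i` uses `s` and the opponent uses `t`. -/
def nextAction {A : Type*} {i : Fin 2} (s : Strategy A i) (t : Strategy A (opponent i))
    (g : List A) : A :=
  if hg : mover g = i then s ⟨g, hg⟩ else t ⟨g, eq_opponent_of_ne hg⟩

/-- The history reached from the history `h` after `n` further actions. -/
def historyAfter {A : Type*} {i : Fin 2} (s : Strategy A i) (t : Strategy A (opponent i))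
    (h : List A) : ℕ → List A
  | 0 => h
  | n + 1 => historyAfter s t h n ++ [nextAction s t (historyAfter s t h n)]

theorem length_historyAfter {A : Type*} {i : Fin 2} (s : Strategy A i)
    (t : Strategy A (opponent i)) (h : List A) (n : ℕ) :
    (historyAfter s t h n).length = h.length + n := by
  induction n with
  | zero => rfl
  | succ n ih => simp only [historyAfter, List.length_append, ih, List.length_singleton]; omega

/-- The play that starts with `h` and continues according to the strategies `s` (of player `i`)
and `t` (of the opponent of `i`). -/
def inducedPlay {A : Type*} {i : Fin 2} (s : Strategy A i) (t : Strategy A (opponent i))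
    (h : List A) (n : ℕ) : A :=
  (historyAfter s t h (n + 1))[n]'(by rw [length_historyAfter]; omega)

/-- The payoff of the player `i` who moves at `h`, in the subgame that starts at `h`, if this
player uses `s` and the opponent uses `t`. -/
def subgamePayoff {A : Type*} (u : Fin 2 → (ℕ → A) → ℝ) (h : List A)
    (s : Strategy A (mover h)) (t : Strategy A (opponent (mover h))) : ℝ :=
  u (mover h) (inducedPlay s t h)

/-- `v` is the value at `h`, for the payoff of the player who moves at `h`:
`v = max over s of min over t = min over t of max over s`, all extrema being attained. -/
def IsValue {A : Type*} (u : Fin 2 → (ℕ → A) → ℝ) (h : List A) (v : ℝ) : Prop :=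
  IsGreatest {x | ∃ s, IsLeast (Set.range fun t => subgamePayoff u h s t) x} v ∧
  IsLeast {x | ∃ t, IsGreatest (Set.range fun s => subgamePayoff u h s t) x} v

/-- The largest payoff that the player who moves at `h` can guarantee in the subgame that starts
at `h`. This is the value at `h` whenever a value exists. -/
noncomputable def maxmin {A : Type*} (u : Fin 2 → (ℕ → A) → ℝ) (h : List A) : ℝ :=
  ⨆ s : Strategy A (mover h), ⨅ t : Strategy A (opponent (mover h)), subgamePayoff u h s t

/-- The play `p` is `α`-monotonic at the history `h`. -/
def IsMonotonicAt {A : Type*} (α : List A → ℝ) (h : List A) (p : ℕ → A) : Prop :=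
  IsPrefixOf h p ∧
  (∀ k l : ℕ, h <+: initial p (2 * k) → k ≤ l →
    α (initial p (2 * k)) ≤ α (initial p (2 * l))) ∧
  (∀ k l : ℕ, h <+: initial p (2 * k + 1) → k ≤ l →
    α (initial p (2 * k + 1)) ≤ α (initial p (2 * l + 1)))

/-- The play `p` is `α`-viable at the history `h`. -/
def IsViableAt {A : Type*} (u : Fin 2 → (ℕ → A) → ℝ) (α : List A → ℝ) (h : List A)
    (p : ℕ → A) : Prop :=
  IsPrefixOf h p ∧ ∀ h' : List A, h <+: h' → IsPrefixOf h' p → α h' ≤ u (mover h') p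

/-- The pair formed by `α` and by the sets of `α`-viable plays. -/
def viableStage {A : Type*} (u : Fin 2 → (ℕ → A) → ℝ) (α : List A → ℝ) :
    (List A → ℝ) × (List A → Set (ℕ → A)) :=
  (α, fun h => {p | IsViableAt u α h p})

/-- The bounds of a successor stage: `max` over actions `a` of `min` over plays in `H (h, a)`. -/
noncomputable def succBound {A : Type*} (u : Fin 2 → (ℕ → A) → ℝ) (H : List A → Set (ℕ → A))
    (h : List A) : ℝ :=
  ⨆ a : A, sInf (u (mover h) '' H (h ++ [a]))

/-- The pair `(α_ξ, H_ξ)`, by recursion on `ξ`. The recursion starts at `ξ = 1`; the entry at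
`ξ = 0` is a placeholder that no other entry uses. -/
noncomputable def stage {A : Type*} (u : Fin 2 → (ℕ → A) → ℝ) (ξ : Ordinal) :
    (List A → ℝ) × (List A → Set (ℕ → A)) :=
  open Classical in
  Ordinal.limitRecOn ξ
    (fun _ => 0, fun _ => ∅)
    (fun ζ S =>
      if ζ = 0 then viableStage u (maxmin u)
      else (succBound u S.2,
        fun h => {p | (∃ a : A, p ∈ S.2 (h ++ [a])) ∧ succBound u S.2 h ≤ u (mover h) p}))
    (fun ζ _ S => viableStage u
      (fun h => sSup {x | ∃ (η : Ordinal) (hη : η < ζ), 1 ≤ η ∧ x = (S η hη).1 h}))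

/-- The real number `α_ξ(h)`. -/
noncomputable def α {A : Type*} (u : Fin 2 → (ℕ → A) → ℝ) (ξ : Ordinal) (h : List A) : ℝ :=
  (stage u ξ).1 h

/-- The set of plays `H_ξ(h)`. -/
noncomputable def H {A : Type*} (u : Fin 2 → (ℕ → A) → ℝ) (ξ : Ordinal) (h : List A) :
    Set (ℕ → A) :=
  (stage u ξ).2 h

/-! The recursion, written out. -/

theorem α_one {A : Type*} (u : Fin 2 → (ℕ → A) → ℝ) (h : List A) :
    α u 1 h = maxmin u h := by
  have e : stage u 1 = viableStage u (maxmin u) := by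
    rw [← zero_add (1 : Ordinal), stage, Ordinal.limitRecOn_add_one, if_pos rfl]
  rw [α, e, viableStage]

theorem H_one {A : Type*} (u : Fin 2 → (ℕ → A) → ℝ) (h : List A) :
    H u 1 h = {p | IsViableAt u (α u 1) h p} := by
  have e : stage u 1 = viableStage u (maxmin u) := by
    rw [← zero_add (1 : Ordinal), stage, Ordinal.limitRecOn_add_one, if_pos rfl]
  have e' : α u 1 = maxmin u := funext (α_one u)
  rw [H, e, e', viableStage]

theorem α_succ {A : Type*} (u : Fin 2 → (ℕ → A) → ℝ) (ξ : Ordinal) (hξ : 1 ≤ ξ) (h : List A) :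
    α u (ξ + 1) h = ⨆ a : A, sInf (u (mover h) '' H u ξ (h ++ [a])) := by
  have h0 : ξ ≠ 0 := Order.one_le_iff_ne_zero.mp hξ
  rw [α, stage, Ordinal.limitRecOn_add_one, if_neg h0]
  rfl

theorem H_succ {A : Type*} (u : Fin 2 → (ℕ → A) → ℝ) (ξ : Ordinal) (hξ : 1 ≤ ξ) (h : List A) :
    H u (ξ + 1) h =
      {p | p ∈ ⋃ a : A, H u ξ (h ++ [a]) ∧ α u (ξ + 1) h ≤ u (mover h) p} := by
  have h0 : ξ ≠ 0 := Order.one_le_iff_ne_zero.mp hξ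
  rw [α_succ u ξ hξ, H, stage, Ordinal.limitRecOn_add_one, if_neg h0]
  ext p
  simp only [Set.mem_iUnion]
  rfl

theorem α_limit {A : Type*} (u : Fin 2 → (ℕ → A) → ℝ) (ξ : Ordinal) (hξ : Order.IsSuccLimit ξ)
    (h : List A) : α u ξ h = sSup ((fun η => α u η h) '' Set.Ico 1 ξ) := by
  rw [α, stage, Ordinal.limitRecOn_limit _ _ _ _ hξ]
  refine congrArg sSup (Set.ext fun x => ⟨?_, ?_⟩)
  · rintro ⟨η, h1, h2, h3⟩
    exact ⟨η, ⟨h2, h1⟩, h3.symm⟩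
  · rintro ⟨η, ⟨h2, h1⟩, h3⟩
    exact ⟨η, h1, h2, h3.symm⟩

theorem H_limit {A : Type*} (u : Fin 2 → (ℕ → A) → ℝ) (ξ : Ordinal) (hξ : Order.IsSuccLimit ξ)
    (h : List A) : H u ξ h = {p | IsViableAt u (α u ξ) h p} := by
  have e : (stage u ξ).2 = fun h => {p | IsViableAt u (stage u ξ).1 h p} := by
    rw [stage, Ordinal.limitRecOn_limit _ _ _ _ hξ]
    rfl
  rw [H, e]
  rfl

end BorelGame

/-! The bounds `α_ξ` concern only the player who moves. The argument works instead with bounds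
`m h k` for both players `k` at every history `h`: for `ξ = 1` the payoff that `k` can guarantee
from `h` on (`lowerValue`), and for a limit ordinal `ξ` the maximum over `η < ξ` of the smallest
payoff of `k` in `H_η(h)` (`limitFloor`). For the mover these agree with `α_ξ`, and all plays in
`H_ξ(h)` respect them. If a play is *steady* for `m`, that is, if along it both coordinates of `m`
are non-decreasing and do not exceed the payoffs of the play, then it is `α_ξ`-viable and
`α_ξ`-monotonic. So the point is the existence of steady plays (`IsFloor`).

As `m` has finitely many values, it suffices to find from each `h` a play whose payoffs, and the
values of `m` along it, do not fall below `m h` (`exists_isSteady`): when `m` increases, one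
restarts. For `ξ = 1` such a play results if both players use strategies that guarantee their
lower values at `h`. Let `ξ` be a limit. Both coordinates of `m h` are the smallest payoffs
`lowest u η h` in `H_η(h)` for some `η < ξ`, and by induction on `η` there is a play that does not
fall below `lowest u η h` (`exists_lowest_le_limitFloor`). For `η = ζ + 1` the mover takes an action
`a` that attains the maximum in the definition of `α_{ζ+1}(h)`; then `H_ζ(h, a) ⊆ H_{ζ+1}(h)`, so
the smallest payoffs of neither player decrease, and the induction hypothesis applies at `(h, a)`
and `ζ`. For `η = 1` and for limits `η` a steady play of stage `η` has this property, since a play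
that is viable at a later history of a steady play is viable from the start, so that the sets
`H_η` shrink along it.

The monotonicity of `α_ξ` and `H_ξ` in `ξ` is proved along with the existence of steady plays in
one transfinite induction (`IsRegularStage`). That the first bound is a value for lower
semicontinuous payoffs is the determinacy of open games: an opponent who never lets the lower
value increase holds the payoff down to it. -/

namespace BorelGame

variable {A : Type*}

/-! ### Plays and their prefixes -/

theorem length_initial (p : ℕ → A) (n : ℕ) : (initial p n).length = n := by
  simp [initial]

theorem initial_succ (p : ℕ → A) (n : ℕ) : initial p (n + 1) = initial p n ++ [p n] := by
  simp [initial, List.range_succ]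

theorem isPrefixOf_initial (p : ℕ → A) (n : ℕ) : IsPrefixOf (initial p n) p := by
  rw [IsPrefixOf, length_initial]

theorem initial_congr {p q : ℕ → A} {n : ℕ} (hpq : ∀ l < n, p l = q l) :
    initial p n = initial q n := by
  simpa [initial] using hpq

theorem apply_eq_of_initial_eq {p q : ℕ → A} {n : ℕ} (hpq : initial p n = initial q n)
    {l : ℕ} (hl : l < n) : p l = q l := by
  simp only [initial, List.map_inj_left, List.mem_range] at hpq
  exact hpq l hl

theorem initial_eq_of_le {p q : ℕ → A} {n : ℕ} (hpq : initial p n = initial q n)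
    {l : ℕ} (hl : l ≤ n) : initial p l = initial q l :=
  initial_congr fun _ hj => apply_eq_of_initial_eq hpq (hj.trans_le hl)

theorem initial_prefix (p : ℕ → A) {m n : ℕ} (hmn : m ≤ n) : initial p m <+: initial p n := by
  obtain ⟨d, rfl⟩ := Nat.exists_eq_add_of_le hmn
  induction d with
  | zero => exact List.prefix_rfl
  | succ d ih =>
    rw [← Nat.add_assoc, initial_succ]
    exact (ih (Nat.le_add_right _ _)).trans (List.prefix_append _ _)

theorem IsPrefixOf.of_initial {p q : ℕ → A} {n : ℕ} {h : List A} (hp : IsPrefixOf h p)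
    (hn : h.length ≤ n) (hq : IsPrefixOf (initial p n) q) : IsPrefixOf h q := by
  rw [IsPrefixOf, length_initial] at hq
  rw [IsPrefixOf, initial_eq_of_le hq hn]
  exact hp

theorem isPrefixOf_append_singleton {h : List A} {a : A} {p : ℕ → A} :
    IsPrefixOf (h ++ [a]) p ↔ IsPrefixOf h p ∧ p h.length = a := by
  simp only [IsPrefixOf, List.length_append, List.length_singleton, initial_succ]
  constructor
  · intro e
    have := List.append_inj' e rfl
    simpa using this
  · rintro ⟨e, rfl⟩
    rw [e]

theorem IsPrefixOf.append {h : List A} {p : ℕ → A} (hp : IsPrefixOf h p) :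
    IsPrefixOf (h ++ [p h.length]) p :=
  isPrefixOf_append_singleton.2 ⟨hp, rfl⟩

theorem IsPrefixOf.initial_succ_length {h : List A} {p : ℕ → A} (hp : IsPrefixOf h p) :
    initial p (h.length + 1) = h ++ [p h.length] := by
  rw [initial_succ, show initial p h.length = h from hp]

theorem mover_append_singleton_ne (h : List A) (a : A) : mover (h ++ [a]) ≠ mover h := by
  rcases Nat.even_or_odd h.length with e | e
  · simp [mover, e, Nat.even_add_one]
  · simp [mover, Nat.not_even_iff_odd.2 e, Nat.even_add_one]

theorem mover_append_singleton_of_ne {h : List A} {k : Fin 2} (hk : mover h ≠ k) (a : A) :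
    mover (h ++ [a]) = k := by
  have := mover_append_singleton_ne h a
  generalize mover (h ++ [a]) = x at *
  generalize mover h = y at *
  revert x y k; decide

/-- Viability in terms of the lengths of the prefixes. -/
theorem isViableAt_iff {u : Fin 2 → (ℕ → A) → ℝ} {f : List A → ℝ} {h : List A} {p : ℕ → A} :
    IsViableAt u f h p ↔
      IsPrefixOf h p ∧ ∀ n, h.length ≤ n → f (initial p n) ≤ u (mover (initial p n)) p := by
  constructor
  · rintro ⟨hp, hv⟩
    refine ⟨hp, fun n hn => hv _ ?_ (isPrefixOf_initial p n)⟩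
    have := initial_prefix p hn
    rwa [show initial p h.length = h from hp] at this
  · rintro ⟨hp, hv⟩
    refine ⟨hp, fun h' hh' hp' => ?_⟩
    have := hv h'.length hh'.length_le
    rwa [show initial p h'.length = h' from hp'] at this

/-- Viability at `h` is viability after one further action, together with the condition at `h`. -/
theorem isViableAt_iff_append {u : Fin 2 → (ℕ → A) → ℝ} {f : List A → ℝ} {h : List A}
    {p : ℕ → A} :
    IsViableAt u f h p ↔ (∃ a, IsViableAt u f (h ++ [a]) p) ∧ f h ≤ u (mover h) p := by
  simp only [isViableAt_iff, isPrefixOf_append_singleton, List.length_append,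
    List.length_singleton]
  constructor
  · rintro ⟨hp, hv⟩
    refine ⟨⟨_, ⟨hp, rfl⟩, fun n hn => hv n (by omega)⟩, ?_⟩
    have := hv _ le_rfl
    rwa [show initial p h.length = h from hp] at this
  · rintro ⟨⟨a, ⟨hp, -⟩, hv⟩, hh⟩
    refine ⟨hp, fun n hn => ?_⟩
    rcases hn.eq_or_lt with rfl | hn
    · rwa [show initial p h.length = h from hp]
    · exact hv n hn

/-! ### Strategies and the plays consistent with them -/

/-- The play `p` passes through `g`, and from there on player `i` follows `s` in it. -/
def IsConsistent {i : Fin 2} (s : Strategy A i) (g : List A) (p : ℕ → A) : Prop :=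
  IsPrefixOf g p ∧
    ∀ n, g.length ≤ n → ∀ hn : mover (initial p n) = i, p n = s ⟨initial p n, hn⟩

theorem IsConsistent.of_initial {i : Fin 2} {s : Strategy A i} {g : List A} {p q : ℕ → A}
    (hp : IsConsistent s g p) {n : ℕ} (hn : g.length ≤ n)
    (hq : IsConsistent s (initial p n) q) : IsConsistent s g q := by
  have e : initial q n = initial p n := by simpa [IsPrefixOf, length_initial] using hq.1
  refine ⟨hp.1.of_initial hn hq.1, fun l hl hm => ?_⟩
  rcases lt_or_ge l n with hln | hln
  · have e' := initial_eq_of_le e hln.le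
    have := hp.2 l hl (by rw [← e']; exact hm)
    rw [apply_eq_of_initial_eq e hln, this]
    simp only [e']
  · exact hq.2 l (by rwa [length_initial]) hm

theorem initial_inducedPlay {i : Fin 2} (s : Strategy A i) (t : Strategy A (opponent i))
    (h : List A) (n : ℕ) :
    initial (inducedPlay s t h) (h.length + n) = historyAfter s t h n := by
  have mono : ∀ m d, historyAfter s t h m <+: historyAfter s t h (m + d) := by
    intro m d
    induction d with
    | zero => exact List.prefix_rfl
    | succ d ih => exact ih.trans (List.prefix_append _ _)
  refine List.ext_getElem (by rw [length_initial, length_historyAfter]) fun l h1 h2 => ?_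
  simp only [initial, List.getElem_map, List.getElem_range, inducedPlay]
  rcases le_total (l + 1) n with hl | hl
  · obtain ⟨d, rfl⟩ := Nat.exists_eq_add_of_le hl
    exact (mono (l + 1) d).getElem _
  · obtain ⟨d, hd⟩ := Nat.exists_eq_add_of_le hl
    have := (mono n d).getElem h2
    simp only [hd]
    exact this.symm

theorem isPrefixOf_inducedPlay {i : Fin 2} (s : Strategy A i) (t : Strategy A (opponent i))
    (h : List A) : IsPrefixOf h (inducedPlay s t h) := by
  rw [IsPrefixOf]
  simpa [historyAfter] using initial_inducedPlay s t h 0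

theorem inducedPlay_apply {i : Fin 2} (s : Strategy A i) (t : Strategy A (opponent i))
    (h : List A) {n : ℕ} (hn : h.length ≤ n) :
    inducedPlay s t h n = nextAction s t (initial (inducedPlay s t h) n) := by
  obtain ⟨d, rfl⟩ := Nat.exists_eq_add_of_le hn
  have e := initial_inducedPlay s t h (d + 1)
  rw [← Nat.add_assoc, initial_succ, historyAfter, ← initial_inducedPlay] at e
  simpa using (List.append_inj' e rfl).2

theorem isConsistent_inducedPlay_left {i : Fin 2} (s : Strategy A i)
    (t : Strategy A (opponent i)) (h : List A) : IsConsistent s h (inducedPlay s t h) :=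
  ⟨isPrefixOf_inducedPlay s t h, fun n hn hm => by
    rw [inducedPlay_apply s t h hn, nextAction, dif_pos hm]⟩

theorem opponent_ne (i : Fin 2) : opponent i ≠ i := by
  revert i; decide

theorem isConsistent_inducedPlay_right {i : Fin 2} (s : Strategy A i)
    (t : Strategy A (opponent i)) (h : List A) : IsConsistent t h (inducedPlay s t h) :=
  ⟨isPrefixOf_inducedPlay s t h, fun n hn hm => by
    rw [inducedPlay_apply s t h hn, nextAction,
      dif_neg (by rw [hm]; exact opponent_ne i)]⟩

/-- Every play consistent with `s` is induced by `s` and some strategy of the opponent, namely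
one that copies the play. -/
theorem IsConsistent.exists_inducedPlay_eq {i : Fin 2} {s : Strategy A i} {g : List A}
    {p : ℕ → A} (hp : IsConsistent s g p) :
    ∃ t : Strategy A (opponent i), inducedPlay s t g = p := by
  refine ⟨fun x => p x.1.length, ?_⟩
  set t : Strategy A (opponent i) := fun x => p x.1.length with ht
  funext n
  induction n using Nat.strong_induction_on with
  | _ n ih =>
    rcases lt_or_ge n g.length with hn | hn
    · exact apply_eq_of_initial_eq ((isPrefixOf_inducedPlay s t g).trans hp.1.symm) hn
    · rw [inducedPlay_apply s t g hn, initial_congr ih, nextAction]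
      split_ifs with hm
      · exact (hp.2 n hn hm).symm
      · simp only [ht, length_initial]

/-- Both players can follow given strategies from `h` on. -/
theorem exists_isConsistent (s : ∀ i : Fin 2, Strategy A i) (h : List A) :
    ∃ p, ∀ i, IsConsistent (s i) h p := by
  refine ⟨inducedPlay (s 0) (s (opponent 0)) h, fun i => ?_⟩
  by_cases hi : i = 0
  · subst hi
    exact isConsistent_inducedPlay_left _ _ _
  · obtain rfl := eq_opponent_of_ne hi
    exact isConsistent_inducedPlay_right _ _ _

/-! ### Lower values -/

/-- The largest payoff that player `k` can guarantee from `g` on. In contrast to `maxmin`, the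
player `k` need not be the one who moves at `g`. -/
noncomputable def lowerValue (u : Fin 2 → (ℕ → A) → ℝ) (g : List A) (k : Fin 2) : ℝ :=
  ⨆ s : Strategy A k, ⨅ t : Strategy A (opponent k), u k (inducedPlay s t g)

theorem α_one_eq_lowerValue (u : Fin 2 → (ℕ → A) → ℝ) (h : List A) :
    α u 1 h = lowerValue u h (mover h) :=
  α_one u h

variable {u : Fin 2 → (ℕ → A) → ℝ}

section

variable [Nonempty A]

theorem exists_guarantee_and_forall_exists_le (hfin : ∀ i, (Set.range (u i)).Finite)
    (g : List A) (k : Fin 2) :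
    (∃ s : Strategy A k, ∀ p, IsConsistent s g p → lowerValue u g k ≤ u k p) ∧
      ∀ s : Strategy A k, ∃ p, IsConsistent s g p ∧ u k p ≤ lowerValue u g k := by
  have hsub (s : Strategy A k) :
      Set.range (fun t : Strategy A (opponent k) => u k (inducedPlay s t g)) ⊆ Set.range (u k) := by
    rintro _ ⟨t, rfl⟩
    exact ⟨_, rfl⟩
  have hmem (s : Strategy A k) : ∃ t : Strategy A (opponent k),
      u k (inducedPlay s t g) = ⨅ t : Strategy A (opponent k), u k (inducedPlay s t g) :=
    (Set.range_nonempty _).csInf_mem ((hfin k).subset (hsub s))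
  have hsub' : Set.range (fun s : Strategy A k =>
      ⨅ t : Strategy A (opponent k), u k (inducedPlay s t g)) ⊆ Set.range (u k) := by
    rintro _ ⟨s, rfl⟩
    obtain ⟨t, ht⟩ := hmem s
    exact ⟨_, ht⟩
  constructor
  · obtain ⟨s, hs⟩ := (Set.range_nonempty _).csSup_mem ((hfin k).subset hsub')
    refine ⟨s, fun p hp => ?_⟩
    obtain ⟨t, rfl⟩ := hp.exists_inducedPlay_eq
    have h1 : lowerValue u g k = _ := hs.symm
    rw [h1]
    exact ciInf_le ((hfin k).subset (hsub s)).bddBelow t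
  · intro s
    obtain ⟨t, ht⟩ := hmem s
    refine ⟨_, isConsistent_inducedPlay_left s t g, ?_⟩
    rw [ht]
    exact le_ciSup (f := fun s : Strategy A k =>
      ⨅ t : Strategy A (opponent k), u k (inducedPlay s t g)) ((hfin k).subset hsub').bddAbove s

/-- The lower value is guaranteed by some strategy. -/
theorem exists_guarantee (hfin : ∀ i, (Set.range (u i)).Finite) (g : List A) (k : Fin 2) :
    ∃ s : Strategy A k, ∀ p, IsConsistent s g p → lowerValue u g k ≤ u k p :=
  (exists_guarantee_and_forall_exists_le hfin g k).1

/-- No strategy guarantees more than the lower value. -/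
theorem exists_le_lowerValue (hfin : ∀ i, (Set.range (u i)).Finite) {g : List A} {k : Fin 2}
    (s : Strategy A k) : ∃ p, IsConsistent s g p ∧ u k p ≤ lowerValue u g k :=
  (exists_guarantee_and_forall_exists_le hfin g k).2 s

theorem le_lowerValue (hfin : ∀ i, (Set.range (u i)).Finite) {g : List A} {k : Fin 2} {c : ℝ}
    (s : Strategy A k) (hs : ∀ p, IsConsistent s g p → c ≤ u k p) : c ≤ lowerValue u g k := by
  obtain ⟨p, hp, hle⟩ := exists_le_lowerValue hfin (g := g) s
  exact (hs p hp).trans hle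

/-- What a strategy guarantees at `g` it guarantees at all later histories that are consistent
with it. -/
theorem IsConsistent.le_lowerValue_initial (hfin : ∀ i, (Set.range (u i)).Finite) {g : List A}
    {k : Fin 2} {c : ℝ} {s : Strategy A k} (hs : ∀ p, IsConsistent s g p → c ≤ u k p)
    {p : ℕ → A} (hp : IsConsistent s g p) {n : ℕ} (hn : g.length ≤ n) :
    c ≤ lowerValue u (initial p n) k :=
  le_lowerValue hfin s fun q hq => hs q (hp.of_initial hn hq)

/-- If the player does not move at `g`, then a strategy guarantees at `g a` what it guarantees
at `g`, whatever the action `a` is. -/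
theorem lowerValue_le_append (hfin : ∀ i, (Set.range (u i)).Finite) {g : List A} {k : Fin 2}
    (hk : mover g ≠ k) (a : A) : lowerValue u g k ≤ lowerValue u (g ++ [a]) k := by
  obtain ⟨s, hs⟩ := exists_guarantee hfin g k
  refine le_lowerValue hfin s fun p hp => hs p ⟨(isPrefixOf_append_singleton.1 hp.1).1, ?_⟩
  intro n hn hm
  rcases hn.eq_or_lt with rfl | hn
  · rw [show initial p g.length = g from (isPrefixOf_append_singleton.1 hp.1).1] at hm
    exact absurd hm hk
  · exact hp.2 n (by simpa using hn) hm

/-- If the player moves at `g`, then no action increases the lower value: the player could have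
chosen this action and followed the better guarantee. -/
theorem lowerValue_append_le (hfin : ∀ i, (Set.range (u i)).Finite) {g : List A} {k : Fin 2}
    (hk : mover g = k) (a : A) : lowerValue u (g ++ [a]) k ≤ lowerValue u g k := by
  classical
  obtain ⟨s, hs⟩ := exists_guarantee hfin (g ++ [a]) k
  refine le_lowerValue hfin (fun x => if x.1 = g then a else s x) fun p hp => hs p ?_
  have e : initial p g.length = g := hp.1
  have h0 : p g.length = a := by
    have := hp.2 g.length le_rfl (by rw [e]; exact hk)
    simpa [e] using this
  refine ⟨isPrefixOf_append_singleton.2 ⟨hp.1, h0⟩, fun n hn hm => ?_⟩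
  simp only [List.length_append, List.length_singleton] at hn
  have := hp.2 n (by omega) hm
  beta_reduce at this
  rwa [if_neg] at this
  intro e'
  have := congrArg List.length e'
  rw [length_initial] at this
  omega

/-- Some action does not increase the lower value. Otherwise the player could guarantee more at
`g` by pasting together the better guarantees at the histories `g a`. -/
theorem exists_lowerValue_append_le (hfin : ∀ i, (Set.range (u i)).Finite) (g : List A)
    (k : Fin 2) : ∃ a, lowerValue u (g ++ [a]) k ≤ lowerValue u g k := by
  by_contra! hcon
  choose S hS using fun a => exists_guarantee hfin (g ++ [a]) k
  obtain ⟨p, hp, hle⟩ := exists_le_lowerValue hfin (g := g) (k := k)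
    (fun x => S (x.1.getD g.length (Classical.arbitrary A)) x)
  refine absurd (hS (p g.length) p ⟨hp.1.append, fun n hn hm => ?_⟩)
    (not_le.2 (hle.trans_lt (hcon _)))
  simp only [List.length_append, List.length_singleton] at hn
  have := hp.2 n (by omega) hm
  have e : (initial p n).getD g.length (Classical.arbitrary A) = p g.length := by
    rw [List.getD_eq_getElem _ _ (by rw [length_initial]; omega)]
    simp [initial]
  beta_reduce at this
  rwa [e] at this

end

/-! ### Determinacy for lower semicontinuous payoffs -/

/-- A lower semicontinuous payoff that exceeds `c` does so because of finitely many actions. -/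
theorem exists_forall_initial_lt [TopologicalSpace A] [DiscreteTopology A] {f : (ℕ → A) → ℝ}
    (hf : LowerSemicontinuous f) {p : ℕ → A} {c : ℝ} (hc : c < f p) (m : ℕ) :
    ∃ n, m ≤ n ∧ ∀ q, initial q n = initial p n → c < f q := by
  have hev := hf p c hc
  rw [nhds_pi, Filter.Eventually, Filter.mem_pi] at hev
  obtain ⟨I, hI, t, ht, hsub⟩ := hev
  obtain ⟨N, hN⟩ := hI.bddAbove
  refine ⟨max m (N + 1), le_max_left _ _, fun q hq => hsub fun i hi => ?_⟩
  rw [apply_eq_of_initial_eq hq ((Nat.lt_succ_of_le (hN hi)).trans_le (le_max_right _ _))]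
  exact mem_of_mem_nhds (ht i)

section

variable [Nonempty A]

/-- Determinacy of open games: an opponent who never lets the lower value of player `k` increase
holds the payoff of `k` down to the lower value. -/
theorem exists_forall_isConsistent_le [TopologicalSpace A] [DiscreteTopology A]
    (hfin : ∀ i, (Set.range (u i)).Finite) {k : Fin 2} (hu : LowerSemicontinuous (u k))
    (g : List A) :
    ∃ t : Strategy A (opponent k), ∀ p, IsConsistent t g p → u k p ≤ lowerValue u g k := by
  choose t ht using fun x : {x : List A // mover x = opponent k} =>
    exists_lowerValue_append_le hfin x.1 k
  refine ⟨t, fun p hp => ?_⟩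
  have key (d : ℕ) : lowerValue u (initial p (g.length + d)) k ≤ lowerValue u g k := by
    induction d with
    | zero => rw [Nat.add_zero, show initial p g.length = g from hp.1]
    | succ d ih =>
      refine le_trans ?_ ih
      rw [← Nat.add_assoc, initial_succ]
      by_cases hm : mover (initial p (g.length + d)) = k
      · exact lowerValue_append_le hfin hm _
      · rw [hp.2 _ (Nat.le_add_right _ _) (eq_opponent_of_ne hm)]
        exact ht ⟨_, eq_opponent_of_ne hm⟩
  by_contra! hlt
  obtain ⟨n, hn, hq⟩ := exists_forall_initial_lt hu hlt g.length
  obtain ⟨d, rfl⟩ := Nat.exists_eq_add_of_le hn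
  -- After a prefix of `p` that forces a payoff above the lower value at `g`, every strategy
  -- guarantees such a payoff.
  obtain ⟨q, hq1, hq2⟩ := exists_le_lowerValue hfin (g := initial p (g.length + d))
    (fun _ : {x : List A // mover x = k} => Classical.arbitrary A)
  have := hq q (by simpa [IsPrefixOf, length_initial] using hq1.1)
  linarith [key d]

/-- The first bound is the value if the payoffs are lower semicontinuous. -/
theorem isValue_α_one [TopologicalSpace A] [DiscreteTopology A]
    (hfin : ∀ i, (Set.range (u i)).Finite) (hu : ∀ i, LowerSemicontinuous (u i)) (h : List A) :
    IsValue u h (α u 1 h) := by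
  rw [α_one_eq_lowerValue]
  obtain ⟨s₀, hs₀⟩ := exists_guarantee hfin h (mover h)
  obtain ⟨t₀, ht₀⟩ := exists_forall_isConsistent_le hfin (hu (mover h)) h
  have hs (t) : lowerValue u h (mover h) ≤ subgamePayoff u h s₀ t :=
    hs₀ _ (isConsistent_inducedPlay_left s₀ t h)
  have ht (s) : subgamePayoff u h s t₀ ≤ lowerValue u h (mover h) :=
    ht₀ _ (isConsistent_inducedPlay_right s t₀ h)
  have e := le_antisymm (ht s₀) (hs t₀)
  refine ⟨⟨⟨s₀, ⟨t₀, e⟩, ?_⟩, ?_⟩, ⟨t₀, ⟨s₀, e⟩, ?_⟩, ?_⟩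
  · rintro _ ⟨t, rfl⟩
    exact hs t
  · rintro x ⟨s, -, hx⟩
    exact (hx ⟨t₀, rfl⟩).trans (ht s)
  · rintro _ ⟨s, rfl⟩
    exact ht s
  · rintro x ⟨t, -, hx⟩
    exact (hs t).trans (hx ⟨s₀, rfl⟩)

end

/-! ### Plays along which a bound does not decrease -/

/-- The play `p` passes through `h`, and from there on both coordinates of `m` are non-decreasing
along `p` and bounded by the payoffs of `p`. -/
def IsSteady (u : Fin 2 → (ℕ → A) → ℝ) (m : List A → Fin 2 → ℝ) (h : List A) (p : ℕ → A) :
    Prop :=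
  IsPrefixOf h p ∧ ∀ n, h.length ≤ n → ∀ k,
    m (initial p n) k ≤ m (initial p (n + 1)) k ∧ m (initial p n) k ≤ u k p

theorem IsSteady.le_of_le {m : List A → Fin 2 → ℝ} {h : List A} {p : ℕ → A}
    (hp : IsSteady u m h p) {a b : ℕ} (ha : h.length ≤ a) (hab : a ≤ b) (k : Fin 2) :
    m (initial p a) k ≤ m (initial p b) k := by
  induction b, hab using Nat.le_induction with
  | base => exact le_rfl
  | succ b hb ih => exact ih.trans (hp.2 b (ha.trans hb) k).1

/-- It is enough to find plays along which `m` does not fall below its initial value: whenever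
`m` has increased, one switches to the play that belongs to the current history, and this happens
finitely often because `m` has finitely many values. -/
theorem exists_isSteady {m : List A → Fin 2 → ℝ} {F : Fin 2 → Set ℝ} (hF : ∀ k, (F k).Finite)
    (hm : ∀ h k, m h k ∈ F k)
    (hex : ∀ h, ∃ p, IsPrefixOf h p ∧ ∀ k, m h k ≤ u k p ∧
      ∀ n, h.length ≤ n → m h k ≤ m (initial p n) k) (h : List A) :
    ∃ p, IsSteady u m h p := by
  -- The number of values of the two coordinates of `m` above those at `h` decreases.
  induction hN : ∑ k, (F k ∩ Set.Ioi (m h k)).ncard using Nat.strong_induction_on generalizing h with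
  | _ N ih =>
    obtain ⟨p, hp, hle⟩ := hex h
    by_cases hcon : ∃ n, h.length ≤ n ∧ m (initial p n) ≠ m h
    · classical
      obtain ⟨hn, hne⟩ := Nat.find_spec hcon
      have hmin {l : ℕ} (hl : l < Nat.find hcon) (hhl : h.length ≤ l) :
          m (initial p l) = m h := by
        by_contra hl'
        exact Nat.find_min hcon hl ⟨hhl, hl'⟩
      set n := Nat.find hcon
      have hmt (k : Fin 2) : m h k ≤ m (initial p n) k := (hle k).2 n hn
      have hlt : ∑ k, (F k ∩ Set.Ioi (m (initial p n) k)).ncard < N := by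
        have hsub (k : Fin 2) : F k ∩ Set.Ioi (m (initial p n) k) ⊆ F k ∩ Set.Ioi (m h k) :=
          Set.inter_subset_inter_right _ (Set.Ioi_subset_Ioi (hmt k))
        have hfi (k : Fin 2) : (F k ∩ Set.Ioi (m h k)).Finite := (hF k).inter_of_left _
        obtain ⟨k, hk⟩ := Function.ne_iff.1 hne
        rw [← hN]
        refine Finset.sum_lt_sum (fun k _ => Set.ncard_le_ncard (hsub k) (hfi k))
          ⟨k, Finset.mem_univ k, Set.ncard_lt_ncard ⟨hsub k, fun hss => ?_⟩ (hfi k)⟩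
        exact (lt_irrefl _ (Set.mem_Ioi.1 (hss ⟨hm _ k, lt_of_le_of_ne (hmt k) (Ne.symm hk)⟩).2))
      obtain ⟨q, hq, hqs⟩ := ih _ hlt (initial p n) rfl
      rw [length_initial] at hqs
      have e : initial q n = initial p n := by simpa [IsPrefixOf, length_initial] using hq
      refine ⟨q, hp.of_initial hn hq, fun l hl k => ?_⟩
      rcases lt_or_ge l n with hln | hln
      · rw [initial_eq_of_le e hln.le, initial_eq_of_le e (Nat.succ_le_of_lt hln), hmin hln hl]
        refine ⟨(hle k).2 _ (by omega), (hmt k).trans ?_⟩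
        rw [← e]
        exact (hqs n le_rfl k).2
      · exact hqs l hln k
    · push Not at hcon
      refine ⟨p, hp, fun n hn k => ?_⟩
      rw [hcon n hn, hcon (n + 1) (by omega)]
      exact ⟨le_rfl, (hle k).1⟩

/-! ### Floors of the stages at which viable plays are taken -/

/-- A bound `m` for both players at all histories that extends the bound `α_ξ` for the player who
moves, that all plays in `H_ξ` respect, and that admits steady plays everywhere. -/
structure IsFloor (u : Fin 2 → (ℕ → A) → ℝ) (ξ : Ordinal.{w}) (m : List A → Fin 2 → ℝ) :
    Prop where
  eq_α : ∀ h, m h (mover h) = α u ξ h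
  le_of_mem : ∀ h, ∀ p ∈ H u ξ h, ∀ k, m h k ≤ u k p
  exists_steady : ∀ h, ∃ p, IsSteady u m h p

theorem mem_H_iff_isViableAt {ξ : Ordinal.{w}} (hξ : ξ = 1 ∨ Order.IsSuccLimit ξ) {h : List A}
    {p : ℕ → A} : p ∈ H u ξ h ↔ IsViableAt u (α u ξ) h p := by
  rcases hξ with rfl | hξ
  · rw [H_one]
    rfl
  · rw [H_limit u ξ hξ]
    rfl

/-- At the first stage the lower values form a floor. If both players use strategies that
guarantee their lower values at `h`, then these do not fall below their initial values. -/
theorem isFloor_lowerValue [Nonempty A] (hfin : ∀ i, (Set.range (u i)).Finite) :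
    IsFloor u (1 : Ordinal.{w}) (lowerValue u) where
  eq_α h := (α_one_eq_lowerValue u h).symm
  le_of_mem h p hp k := by
    rw [mem_H_iff_isViableAt (Or.inl rfl), isViableAt_iff] at hp
    obtain ⟨hp, hv⟩ := hp
    by_cases hk : mover h = k
    · have := hv _ le_rfl
      rwa [show initial p h.length = h from hp, α_one_eq_lowerValue, hk] at this
    · have := hv _ (Nat.le_succ _)
      rw [hp.initial_succ_length, α_one_eq_lowerValue, mover_append_singleton_of_ne hk] at this
      exact (lowerValue_le_append hfin hk _).trans this
  exists_steady := by
    refine exists_isSteady (F := fun k => Set.range (u k)) hfin (fun h k => ?_) fun h => ?_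
    · obtain ⟨s, hs⟩ := exists_guarantee hfin h k
      obtain ⟨p, hp, hle⟩ := exists_le_lowerValue hfin (g := h) s
      exact ⟨p, le_antisymm hle (hs p hp)⟩
    · choose s hs using exists_guarantee hfin h
      obtain ⟨p, hp⟩ := exists_isConsistent s h
      exact ⟨p, (hp 0).1, fun k => ⟨hs k p (hp k), fun n hn =>
        (hp k).le_lowerValue_initial hfin (hs k) hn⟩⟩

namespace IsFloor

variable {ξ : Ordinal.{w}} {m : List A → Fin 2 → ℝ}

theorem mem_H (hm : IsFloor u ξ m) (hξ : ξ = 1 ∨ Order.IsSuccLimit ξ) {h : List A} {p : ℕ → A}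
    (hp : IsSteady u m h p) : p ∈ H u ξ h := by
  rw [mem_H_iff_isViableAt hξ, isViableAt_iff]
  refine ⟨hp.1, fun n hn => ?_⟩
  rw [← hm.eq_α]
  exact (hp.2 n hn _).2

/-- A play that is viable at a later history of a steady play is viable from the start. -/
theorem H_initial_subset (hm : IsFloor u ξ m) (hξ : ξ = 1 ∨ Order.IsSuccLimit ξ) {h : List A}
    {p : ℕ → A} (hp : IsSteady u m h p) {n : ℕ} (hn : h.length ≤ n) :
    H u ξ (initial p n) ⊆ H u ξ h := by
  intro q hq
  have hmq := hm.le_of_mem _ q hq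
  rw [mem_H_iff_isViableAt hξ, isViableAt_iff] at hq ⊢
  rw [length_initial] at hq
  refine ⟨hp.1.of_initial hn hq.1, fun l hl => ?_⟩
  rcases le_total l n with hln | hln
  · have e : initial q n = initial p n := by simpa [IsPrefixOf, length_initial] using hq.1
    rw [initial_eq_of_le e hln, ← hm.eq_α]
    exact (hp.le_of_le hl hln _).trans (hmq _)
  · exact hq.2 l hln

/-- The first action of a steady play secures the bound at `h`. -/
theorem exists_append_le (hm : IsFloor u ξ m) (h : List A) :
    ∃ a, ∀ p ∈ H u ξ (h ++ [a]), α u ξ h ≤ u (mover h) p := by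
  obtain ⟨p, hp⟩ := hm.exists_steady h
  -- The coordinate of the mover at `h` is compared with `m` at `h ++ [a]`, where `α u ξ` says
  -- nothing about this player.
  refine ⟨p h.length, fun q hq => ?_⟩
  have := (hp.2 _ le_rfl (mover h)).1
  rw [hp.1.initial_succ_length, show initial p h.length = h from hp.1, hm.eq_α] at this
  exact this.trans (hm.le_of_mem _ q hq _)

theorem isMonotonicAt (hm : IsFloor u ξ m) {h : List A} {p : ℕ → A} (hp : IsSteady u m h p) :
    IsMonotonicAt (α u ξ) h p := by
  have key {a b : ℕ} (ha : h <+: initial p a) (hab : a ≤ b)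
      (hpar : mover (initial p a) = mover (initial p b)) :
      α u ξ (initial p a) ≤ α u ξ (initial p b) := by
    rw [← hm.eq_α, ← hm.eq_α, hpar]
    exact hp.le_of_le (by simpa [length_initial] using ha.length_le) hab _
  refine ⟨hp.1, fun k l hk hkl => key hk (by omega) ?_, fun k l hk hkl => key hk (by omega) ?_⟩ <;>
    simp [mover, length_initial, parity_simps]

end IsFloor

/-! ### The smallest payoffs in the sets `H_ξ` -/

/-- The smallest payoff of player `k` among the plays in `H_ξ(h)`; it is `0` if there are none. -/
noncomputable def lowest (u : Fin 2 → (ℕ → A) → ℝ) (ξ : Ordinal.{w}) (h : List A) (k : Fin 2) :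
    ℝ :=
  sInf (u k '' H u ξ h)

theorem finite_image (hfin : ∀ i, (Set.range (u i)).Finite) (k : Fin 2) (S : Set (ℕ → A)) :
    (u k '' S).Finite :=
  (hfin k).subset (Set.image_subset_range _ _)

theorem lowest_le (hfin : ∀ i, (Set.range (u i)).Finite) {ξ : Ordinal.{w}} {h : List A}
    {p : ℕ → A} (hp : p ∈ H u ξ h) (k : Fin 2) : lowest u ξ h k ≤ u k p :=
  csInf_le (finite_image hfin k _).bddBelow ⟨p, hp, rfl⟩

theorem le_lowest {ξ : Ordinal.{w}} {h : List A} {k : Fin 2} {c : ℝ} (hne : (H u ξ h).Nonempty)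
    (hc : ∀ p ∈ H u ξ h, c ≤ u k p) : c ≤ lowest u ξ h k :=
  le_csInf (hne.image _) (Set.forall_mem_image.2 hc)

theorem isLeast_lowest (hfin : ∀ i, (Set.range (u i)).Finite) {ξ : Ordinal.{w}} {h : List A}
    (hne : (H u ξ h).Nonempty) (k : Fin 2) :
    IsLeast (u k '' H u ξ h) (lowest u ξ h k) :=
  ⟨(hne.image _).csInf_mem (finite_image hfin k _),
    fun _ hx => csInf_le (finite_image hfin k _).bddBelow hx⟩

theorem lowest_mono (hfin : ∀ i, (Set.range (u i)).Finite) {ξ η : Ordinal.{w}} {h g : List A}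
    (hne : (H u η g).Nonempty) (hsub : H u η g ⊆ H u ξ h) (k : Fin 2) :
    lowest u ξ h k ≤ lowest u η g k :=
  le_lowest hne fun _ hp => lowest_le hfin (hsub hp) k

/-- The value `0` accounts for the convention `sInf ∅ = 0`. -/
theorem lowest_mem (hfin : ∀ i, (Set.range (u i)).Finite) (ξ : Ordinal.{w}) (h : List A)
    (k : Fin 2) : lowest u ξ h k ∈ insert 0 (Set.range (u k)) := by
  rcases (H u ξ h).eq_empty_or_nonempty with e | hne
  · simp [lowest, e]
  · exact Or.inr (Set.image_subset_range _ _ (isLeast_lowest hfin hne k).1)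

theorem isGreatest_α_succ [Nonempty A] (hfin : ∀ i, (Set.range (u i)).Finite) {ξ : Ordinal.{w}}
    (hξ : 1 ≤ ξ) (h : List A) :
    IsGreatest (Set.range fun a : A => lowest u ξ (h ++ [a]) (mover h)) (α u (ξ + 1) h) := by
  have hf : (Set.range fun a : A => lowest u ξ (h ++ [a]) (mover h)).Finite := by
    refine ((hfin (mover h)).insert 0).subset ?_
    rintro _ ⟨a, rfl⟩
    exact lowest_mem hfin _ _ _
  rw [α_succ u ξ hξ]
  exact ⟨(Set.range_nonempty _).csSup_mem hf, fun _ hx => le_csSup hf.bddAbove hx⟩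

theorem mem_H_succ {ξ : Ordinal.{w}} (hξ : 1 ≤ ξ) {h : List A} {p : ℕ → A} :
    p ∈ H u (ξ + 1) h ↔
      (∃ a, p ∈ H u ξ (h ++ [a])) ∧ α u (ξ + 1) h ≤ u (mover h) p := by
  rw [H_succ u ξ hξ]
  change (p ∈ ⋃ a : A, H u ξ (h ++ [a])) ∧ _ ↔ _
  rw [Set.mem_iUnion]

/-- If `a` attains the maximum in the definition of `α_{ξ+1}(h)`, then `H_ξ(h, a)` is contained in
`H_{ξ+1}(h)`, so that its plays satisfy the bounds of both players. -/
theorem exists_α_succ_eq [Nonempty A] (hfin : ∀ i, (Set.range (u i)).Finite) {ξ : Ordinal.{w}}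
    (hξ : 1 ≤ ξ) (h : List A) :
    ∃ a, α u (ξ + 1) h = lowest u ξ (h ++ [a]) (mover h) ∧
      H u ξ (h ++ [a]) ⊆ H u (ξ + 1) h := by
  obtain ⟨a, ha⟩ := (isGreatest_α_succ hfin hξ h).1
  refine ⟨a, ha.symm, fun p hp => (mem_H_succ hξ).2 ⟨⟨a, hp⟩, ?_⟩⟩
  rw [← ha]
  exact lowest_le hfin hp _

/-- At successor stages the bound of the mover is the smallest payoff in the set of plays. -/
theorem lowest_succ_mover [Nonempty A] (hfin : ∀ i, (Set.range (u i)).Finite) {ξ : Ordinal.{w}}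
    (hξ : 1 ≤ ξ) (hne : ∀ h, (H u ξ h).Nonempty) (h : List A) :
    lowest u (ξ + 1) h (mover h) = α u (ξ + 1) h := by
  obtain ⟨a, ha, hsub⟩ := exists_α_succ_eq hfin hξ h
  refine le_antisymm ?_ (le_lowest ((hne _).mono hsub) fun p hp => ((mem_H_succ hξ).1 hp).2)
  rw [ha]
  exact lowest_mono hfin (hne _) hsub _

/-- All bounds lie in one finite set; `0` accounts for the conventions for empty sets. -/
theorem α_mem [Nonempty A] (hfin : ∀ i, (Set.range (u i)).Finite) {ξ : Ordinal.{w}} (hξ : 1 ≤ ξ)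
    (h : List A) : α u ξ h ∈ insert 0 (Set.range (u (mover h))) := by
  induction ξ using Ordinal.limitRecOn with
  | zero => exact absurd hξ (by simp)
  | add_one ξ _ =>
    rcases eq_or_ne ξ 0 with rfl | h0
    · obtain ⟨s, hs⟩ := exists_guarantee hfin h (mover h)
      obtain ⟨p, hp, hle⟩ := exists_le_lowerValue hfin (g := h) s
      rw [zero_add, α_one_eq_lowerValue]
      exact Or.inr ⟨p, le_antisymm hle (hs p hp)⟩
    · obtain ⟨a, ha, -⟩ := exists_α_succ_eq hfin (u := u) (Order.one_le_iff_ne_zero.2 h0) h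
      rw [ha]
      exact lowest_mem hfin _ _ _
  | limit ξ hlim ih =>
    rw [α_limit u ξ hlim]
    have hsub : (fun η => α u η h) '' Set.Ico 1 ξ ⊆ insert 0 (Set.range (u (mover h))) := by
      rintro _ ⟨η, hη, rfl⟩
      exact ih η hη.2 hη.1
    rcases ((fun η => α u η h) '' Set.Ico 1 ξ).eq_empty_or_nonempty with e | hne
    · simp [e]
    · exact hsub (hne.csSup_mem (((hfin _).insert 0).subset hsub))

theorem finite_α_image [Nonempty A] (hfin : ∀ i, (Set.range (u i)).Finite) (ξ : Ordinal.{w})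
    (h : List A) : ((fun η => α u η h) '' Set.Ico 1 ξ).Finite := by
  refine ((hfin (mover h)).insert 0).subset ?_
  rintro _ ⟨η, hη, rfl⟩
  exact α_mem hfin hη.1 h

theorem one_lt_of_isSuccLimit {ξ : Ordinal.{w}} (hξ : Order.IsSuccLimit ξ) : 1 < ξ := by
  simpa using hξ.succ_lt hξ.bot_lt

theorem isGreatest_α_limit [Nonempty A] (hfin : ∀ i, (Set.range (u i)).Finite) {ξ : Ordinal.{w}}
    (hξ : Order.IsSuccLimit ξ) (h : List A) :
    IsGreatest ((fun η => α u η h) '' Set.Ico 1 ξ) (α u ξ h) := by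
  have hf := finite_α_image hfin ξ h
  have hne : ((fun η => α u η h) '' Set.Ico 1 ξ).Nonempty :=
    ⟨_, 1, ⟨le_rfl, one_lt_of_isSuccLimit hξ⟩, rfl⟩
  rw [α_limit u ξ hξ]
  exact ⟨hne.csSup_mem hf, fun _ hx => le_csSup hf.bddAbove hx⟩

/-! ### The floor at a limit stage -/

/-- The properties of stage `ξ` that are proved by transfinite induction. -/
structure IsRegularStage (u : Fin 2 → (ℕ → A) → ℝ) (ξ : Ordinal.{w}) : Prop where
  nonempty : ∀ h, (H u ξ h).Nonempty
  subset : ∀ η, 1 ≤ η → η ≤ ξ → ∀ h, H u ξ h ⊆ H u η h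
  α_le : ∀ η, 1 ≤ η → η ≤ ξ → ∀ h, α u η h ≤ α u ξ h
  exists_floor : ξ = 1 ∨ Order.IsSuccLimit ξ → ∃ m, IsFloor u ξ m

/-- The largest of the smallest payoffs of player `k` in the sets of plays of the stages
before `ξ`. -/
noncomputable def limitFloor (u : Fin 2 → (ℕ → A) → ℝ) (ξ : Ordinal.{w}) (h : List A)
    (k : Fin 2) : ℝ :=
  sSup ((fun η => lowest u η h k) '' Set.Ico 1 ξ)

theorem isGreatest_limitFloor (hfin : ∀ i, (Set.range (u i)).Finite) {ξ : Ordinal.{w}}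
    (hξ : Order.IsSuccLimit ξ) (h : List A) (k : Fin 2) :
    IsGreatest ((fun η => lowest u η h k) '' Set.Ico 1 ξ) (limitFloor u ξ h k) := by
  have hf : ((fun η => lowest u η h k) '' Set.Ico 1 ξ).Finite := by
    refine ((hfin k).insert 0).subset ?_
    rintro _ ⟨η, -, rfl⟩
    exact lowest_mem hfin η h k
  exact ⟨Set.Nonempty.csSup_mem ⟨_, 1, ⟨le_rfl, one_lt_of_isSuccLimit hξ⟩, rfl⟩ hf,
    fun _ hx => le_csSup hf.bddAbove hx⟩

theorem lowest_le_limitFloor (hfin : ∀ i, (Set.range (u i)).Finite) {ξ η : Ordinal.{w}}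
    (hξ : Order.IsSuccLimit ξ) (h1 : 1 ≤ η) (h2 : η < ξ) (h : List A) (k : Fin 2) :
    lowest u η h k ≤ limitFloor u ξ h k :=
  (isGreatest_limitFloor hfin hξ h k).2 ⟨η, ⟨h1, h2⟩, rfl⟩

/-- Both maxima are attained at one common stage. -/
theorem exists_limitFloor_eq (hfin : ∀ i, (Set.range (u i)).Finite) {ξ : Ordinal.{w}}
    (hξ : Order.IsSuccLimit ξ) (ih : ∀ η, 1 ≤ η → η < ξ → IsRegularStage u η) (h : List A) :
    ∃ η, 1 ≤ η ∧ η < ξ ∧ ∀ k, limitFloor u ξ h k = lowest u η h k := by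
  choose η hη heq using fun k => (isGreatest_limitFloor hfin hξ h k).1
  have hmax (k : Fin 2) : η k ≤ max (η 0) (η 1) := by
    fin_cases k
    exacts [le_max_left _ _, le_max_right _ _]
  have h1 : 1 ≤ max (η 0) (η 1) := (hη 0).1.trans (hmax 0)
  have h2 : max (η 0) (η 1) < ξ := max_lt (hη 0).2 (hη 1).2
  refine ⟨_, h1, h2, fun k => le_antisymm ?_ (lowest_le_limitFloor hfin hξ h1 h2 h k)⟩
  rw [← heq k]
  exact lowest_mono hfin ((ih _ h1 h2).nonempty h)
    ((ih _ h1 h2).subset _ (hη k).1 (hmax k) h) k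

theorem eq_one_or_isSuccLimit_or_eq_add_one {ξ : Ordinal.{w}} (hξ : 1 ≤ ξ) :
    (ξ = 1 ∨ Order.IsSuccLimit ξ) ∨ ∃ η, 1 ≤ η ∧ ξ = η + 1 := by
  rcases Ordinal.zero_or_succ_or_isSuccLimit ξ with rfl | ⟨η, rfl⟩ | hlim
  · exact absurd hξ (by simp)
  · rcases eq_or_ne η 0 with rfl | h0
    · simp
    · exact Or.inr ⟨η, Order.one_le_iff_ne_zero.2 h0, by simp⟩
  · exact Or.inl (Or.inr hlim)

/-- From every history there is a play that does not fall below the smallest payoffs in `H_η`,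
neither with its payoffs nor with the limit floors of its prefixes. If viable plays are taken at
stage `η`, then it is a steady play of that stage, because `H_η` shrinks along such a play. For a
successor `η + 1` one takes an action attaining the maximum, and continues with stage `η`. -/
theorem exists_lowest_le_limitFloor [Nonempty A] (hfin : ∀ i, (Set.range (u i)).Finite)
    {ξ : Ordinal.{w}} (hξ : Order.IsSuccLimit ξ)
    (ih : ∀ η, 1 ≤ η → η < ξ → IsRegularStage u η) {η : Ordinal.{w}} (h1 : 1 ≤ η) (h2 : η < ξ)
    (h : List A) :
    ∃ p, IsPrefixOf h p ∧ ∀ k, lowest u η h k ≤ u k p ∧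
      ∀ n, h.length ≤ n → lowest u η h k ≤ limitFloor u ξ (initial p n) k := by
  induction η using WellFoundedLT.induction generalizing h with
  | _ η ihη =>
    rcases eq_one_or_isSuccLimit_or_eq_add_one h1 with hbase | ⟨ζ, hζ, rfl⟩
    · obtain ⟨m, hm⟩ := (ih η h1 h2).exists_floor hbase
      obtain ⟨p, hp⟩ := hm.exists_steady h
      refine ⟨p, hp.1, fun k => ⟨lowest_le hfin (hm.mem_H hbase hp) k, fun n hn => ?_⟩⟩
      exact (lowest_mono hfin ((ih η h1 h2).nonempty _) (hm.H_initial_subset hbase hp hn) k).trans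
        (lowest_le_limitFloor hfin hξ h1 h2 _ k)
    · have hlt : ζ < ζ + 1 := lt_add_one ζ
      obtain ⟨a, -, hsub⟩ := exists_α_succ_eq hfin hζ h
      obtain ⟨p, hp, hle⟩ := ihη ζ hlt hζ (hlt.trans h2) (h ++ [a])
      have hmono := lowest_mono hfin ((ih ζ hζ (hlt.trans h2)).nonempty _) hsub
      have hp' := (isPrefixOf_append_singleton.1 hp).1
      refine ⟨p, hp', fun k => ⟨(hmono k).trans (hle k).1, fun n hn => ?_⟩⟩
      rcases hn.eq_or_lt with rfl | hn
      · rw [show initial p h.length = h from hp']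
        exact lowest_le_limitFloor hfin hξ h1 h2 h k
      · exact (hmono k).trans ((hle k).2 n (by simpa using hn))

/-- A play that is viable for the bounds of a limit stage belongs to all earlier sets. -/
theorem H_limit_subset (hfin : ∀ i, (Set.range (u i)).Finite) [Nonempty A] {ξ : Ordinal.{w}}
    (hξ : Order.IsSuccLimit ξ) {η : Ordinal.{w}} (h1 : 1 ≤ η) (h2 : η < ξ) (h : List A) :
    H u ξ h ⊆ H u η h := by
  have hα {η : Ordinal.{w}} (h1 : 1 ≤ η) (h2 : η < ξ) (h : List A) : α u η h ≤ α u ξ h :=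
    (isGreatest_α_limit hfin hξ h).2 ⟨η, ⟨h1, h2⟩, rfl⟩
  -- A viable play at `h` is viable after one more action, so successors `η` reduce to `η - 1`.
  induction η using WellFoundedLT.induction generalizing h with
  | _ η ihη =>
    intro p hp
    have hv := (mem_H_iff_isViableAt (Or.inr hξ)).1 hp
    rcases eq_one_or_isSuccLimit_or_eq_add_one h1 with hbase | ⟨ζ, hζ, rfl⟩
    · rw [mem_H_iff_isViableAt hbase]
      exact ⟨hv.1, fun h' hh' hp' => (hα h1 h2 h').trans (hv.2 h' hh' hp')⟩
    · have hlt : ζ < ζ + 1 := lt_add_one ζ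
      obtain ⟨⟨a, ha⟩, hle⟩ := isViableAt_iff_append.1 hv
      exact (mem_H_succ hζ).2 ⟨⟨a, ihη ζ hlt hζ (hlt.trans h2) _
        ((mem_H_iff_isViableAt (Or.inr hξ)).2 ha)⟩, (hα h1 h2 h).trans hle⟩

theorem isFloor_limitFloor [Nonempty A] (hfin : ∀ i, (Set.range (u i)).Finite)
    {ξ : Ordinal.{w}} (hξ : Order.IsSuccLimit ξ)
    (ih : ∀ η, 1 ≤ η → η < ξ → IsRegularStage u η) : IsFloor u ξ (limitFloor u ξ) where
  eq_α h := by
    have hsucc {η : Ordinal.{w}} (h1 : 1 ≤ η) (h2 : η < ξ) :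
        α u η h ≤ lowest u (η + 1) h (mover h) ∧ lowest u η h (mover h) ≤ α u (η + 1) h := by
      have h3 : η + 1 < ξ := by simpa using hξ.succ_lt h2
      have h4 : η ≤ η + 1 := (lt_add_one η).le
      have hreg := ih _ (h1.trans h4) h3
      have e := lowest_succ_mover hfin h1 (ih η h1 h2).nonempty h
      refine ⟨(hreg.α_le η h1 h4 h).trans e.ge, e.le.trans' ?_⟩
      exact lowest_mono hfin (hreg.nonempty h) (hreg.subset η h1 h4 h) _
    -- For the mover the bounds and the smallest payoffs interlace.
    refine le_antisymm ?_ ?_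
    · obtain ⟨η, ⟨h1, h2⟩, e⟩ := (isGreatest_limitFloor hfin hξ h (mover h)).1
      rw [← e]
      exact (hsucc h1 h2).2.trans ((isGreatest_α_limit hfin hξ h).2
        ⟨η + 1, ⟨h1.trans (lt_add_one η).le, by simpa using hξ.succ_lt h2⟩, rfl⟩)
    · obtain ⟨η, ⟨h1, h2⟩, e⟩ := (isGreatest_α_limit hfin hξ h).1
      rw [← e]
      exact (hsucc h1 h2).1.trans (lowest_le_limitFloor hfin hξ
        (h1.trans (lt_add_one η).le) (by simpa using hξ.succ_lt h2) h _)
  le_of_mem h p hp k := by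
    obtain ⟨η, ⟨h1, h2⟩, e⟩ := (isGreatest_limitFloor hfin hξ h k).1
    rw [← e]
    exact lowest_le hfin (H_limit_subset hfin hξ h1 h2 h hp) k
  exists_steady := by
    refine exists_isSteady (F := fun k => insert 0 (Set.range (u k)))
      (fun k => (hfin k).insert 0) (fun h k => ?_) fun h => ?_
    · obtain ⟨η, -, e⟩ := (isGreatest_limitFloor hfin hξ h k).1
      rw [← e]
      exact lowest_mem hfin η h k
    · obtain ⟨η, h1, h2, e⟩ := exists_limitFloor_eq hfin hξ ih h
      simp only [e]
      exact exists_lowest_le_limitFloor hfin hξ ih h1 h2 h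

/-! ### The transfinite induction -/

theorem IsFloor.nonempty {ξ : Ordinal.{w}} {m : List A → Fin 2 → ℝ} (hm : IsFloor u ξ m)
    (hξ : ξ = 1 ∨ Order.IsSuccLimit ξ) (h : List A) : (H u ξ h).Nonempty := by
  obtain ⟨p, hp⟩ := hm.exists_steady h
  exact ⟨p, hm.mem_H hξ hp⟩

theorem IsRegularStage.one [Nonempty A] (hfin : ∀ i, (Set.range (u i)).Finite) :
    IsRegularStage u (1 : Ordinal.{w}) where
  nonempty := (isFloor_lowerValue hfin).nonempty (Or.inl rfl)
  subset η h1 h2 h := by rw [le_antisymm h2 h1]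
  α_le η h1 h2 h := by rw [le_antisymm h2 h1]
  exists_floor _ := ⟨_, isFloor_lowerValue hfin⟩

theorem IsRegularStage.limit [Nonempty A] (hfin : ∀ i, (Set.range (u i)).Finite)
    {ξ : Ordinal.{w}} (hξ : Order.IsSuccLimit ξ)
    (ih : ∀ η, 1 ≤ η → η < ξ → IsRegularStage u η) : IsRegularStage u ξ where
  nonempty := (isFloor_limitFloor hfin hξ ih).nonempty (Or.inr hξ)
  subset η h1 h2 h := by
    rcases h2.eq_or_lt with rfl | h2
    · exact subset_rfl
    · exact H_limit_subset hfin hξ h1 h2 h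
  α_le η h1 h2 h := by
    rcases h2.eq_or_lt with rfl | h2
    · exact le_rfl
    · exact (isGreatest_α_limit hfin hξ h).2 ⟨η, ⟨h1, h2⟩, rfl⟩
  exists_floor _ := ⟨_, isFloor_limitFloor hfin hξ ih⟩

theorem IsRegularStage.α_le_α_succ [Nonempty A] (hfin : ∀ i, (Set.range (u i)).Finite)
    {ξ : Ordinal.{w}} (hξ : 1 ≤ ξ) (hreg : IsRegularStage u ξ) (h : List A) :
    α u ξ h ≤ α u (ξ + 1) h := by
  obtain ⟨a, ha⟩ : ∃ a, ∀ p ∈ H u ξ (h ++ [a]), α u ξ h ≤ u (mover h) p := by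
    rcases eq_one_or_isSuccLimit_or_eq_add_one hξ with hbase | ⟨ζ, hζ, rfl⟩
    · obtain ⟨m, hm⟩ := hreg.exists_floor hbase
      exact hm.exists_append_le h
    · obtain ⟨a, ha, -⟩ := exists_α_succ_eq hfin hζ h
      refine ⟨a, fun p hp => ?_⟩
      rw [ha]
      exact lowest_le hfin (hreg.subset ζ hζ (lt_add_one ζ).le _ hp) _
  exact (le_lowest (hreg.nonempty _) ha).trans ((isGreatest_α_succ hfin hξ h).2 ⟨a, rfl⟩)

theorem IsRegularStage.H_succ_subset [Nonempty A] (hfin : ∀ i, (Set.range (u i)).Finite)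
    {ξ : Ordinal.{w}} (hξ : 1 ≤ ξ) (hreg : IsRegularStage u ξ) (h : List A) :
    H u (ξ + 1) h ⊆ H u ξ h := by
  intro p hp
  obtain ⟨⟨a, ha⟩, hle⟩ := (mem_H_succ hξ).1 hp
  replace hle := (hreg.α_le_α_succ hfin hξ h).trans hle
  rcases eq_one_or_isSuccLimit_or_eq_add_one hξ with hbase | ⟨ζ, hζ, rfl⟩
  · rw [mem_H_iff_isViableAt hbase] at ha ⊢
    exact isViableAt_iff_append.2 ⟨⟨a, ha⟩, hle⟩
  · exact (mem_H_succ hζ).2 ⟨⟨a, hreg.subset ζ hζ (lt_add_one ζ).le _ ha⟩, hle⟩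

theorem IsRegularStage.succ [Nonempty A] (hfin : ∀ i, (Set.range (u i)).Finite)
    {ξ : Ordinal.{w}} (hξ : 1 ≤ ξ) (hreg : IsRegularStage u ξ) : IsRegularStage u (ξ + 1) where
  nonempty h := by
    obtain ⟨a, -, hsub⟩ := exists_α_succ_eq hfin hξ h
    exact (hreg.nonempty _).mono hsub
  subset η h1 h2 h := by
    rcases h2.eq_or_lt with rfl | h2
    · exact subset_rfl
    · exact (hreg.H_succ_subset hfin hξ h).trans (hreg.subset η h1 (Order.lt_add_one_iff.1 h2) h)
  α_le η h1 h2 h := by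
    rcases h2.eq_or_lt with rfl | h2
    · exact le_rfl
    · exact (hreg.α_le η h1 (Order.lt_add_one_iff.1 h2) h).trans (hreg.α_le_α_succ hfin hξ h)
  exists_floor hbase := by
    rcases hbase with e | hlim
    · exact absurd e (hξ.trans_lt (lt_add_one ξ)).ne'
    · exact absurd (hlim.succ_lt (lt_add_one ξ)) (by simp)

theorem isRegularStage [Nonempty A] (hfin : ∀ i, (Set.range (u i)).Finite) {ξ : Ordinal.{w}}
    (hξ : 1 ≤ ξ) : IsRegularStage u ξ := by
  induction ξ using WellFoundedLT.induction with
  | _ ξ ih =>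
    rcases eq_one_or_isSuccLimit_or_eq_add_one hξ with (rfl | hlim) | ⟨ζ, hζ, rfl⟩
    · exact .one hfin
    · exact .limit hfin hlim fun η h1 h2 => ih η h2 h1
    · exact (ih ζ (lt_add_one ζ) hζ).succ hfin hζ

end BorelGame

theorem theorem17 {A : Type*} [Nonempty A] [TopologicalSpace A] [DiscreteTopology A]
    (u : Fin 2 → (ℕ → A) → ℝ) (hfin : ∀ i, (Set.range (u i)).Finite) (h : List A) :
    -- the first bound is the value (for lower semicontinuous payoffs), and the maxima and minima
    -- in the recursion are attained
    ((∀ i, LowerSemicontinuous (u i)) → BorelGame.IsValue u h (BorelGame.α u (1 : Ordinal.{w}) h)) ∧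
    (∀ ξ : Ordinal.{w}, 1 ≤ ξ →
      IsGreatest {x | ∃ a : A, IsLeast (u (BorelGame.mover h) '' BorelGame.H u ξ (h ++ [a])) x}
        (BorelGame.α u (ξ + 1) h)) ∧
    (∀ ξ : Ordinal.{w}, Order.IsSuccLimit ξ →
      IsGreatest ((fun η => BorelGame.α u η h) '' Set.Ico 1 ξ) (BorelGame.α u ξ h)) ∧
    -- 1.
    (∀ ξ : Ordinal.{w}, 1 ≤ ξ → (BorelGame.H u ξ h).Nonempty) ∧
    -- 2.
    (∀ ξ η : Ordinal.{w}, 1 ≤ ξ → ξ ≤ η → BorelGame.H u η h ⊆ BorelGame.H u ξ h) ∧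
    -- 3.
    (∀ ξ η : Ordinal.{w}, 1 ≤ ξ → ξ ≤ η → BorelGame.α u ξ h ≤ BorelGame.α u η h) ∧
    -- 4.
    (∀ ξ : Ordinal.{w}, ξ = 1 ∨ Order.IsSuccLimit ξ →
      ∃ p ∈ BorelGame.H u ξ h, BorelGame.IsMonotonicAt (BorelGame.α u ξ) h p) := by
  refine ⟨fun hu => BorelGame.isValue_α_one hfin hu h, fun ξ hξ => ?_,
    fun ξ hξ => BorelGame.isGreatest_α_limit hfin hξ h,
    fun ξ hξ => (BorelGame.isRegularStage hfin hξ).nonempty h,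
    fun ξ η h1 h2 => (BorelGame.isRegularStage hfin (h1.trans h2)).subset ξ h1 h2 h,
    fun ξ η h1 h2 => (BorelGame.isRegularStage hfin (h1.trans h2)).α_le ξ h1 h2 h,
    fun ξ hξ => ?_⟩
  · have hleast (a : A) := BorelGame.isLeast_lowest hfin
      ((BorelGame.isRegularStage hfin hξ).nonempty (h ++ [a])) (BorelGame.mover h)
    obtain ⟨⟨a, ha⟩, hub⟩ := BorelGame.isGreatest_α_succ hfin hξ h
    refine ⟨⟨a, ha ▸ hleast a⟩, ?_⟩
    rintro x ⟨b, hb⟩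
    exact hub ⟨b, (hleast b).unique hb⟩
  · have h1 : 1 ≤ ξ := hξ.elim (fun e => e.ge) fun hlim =>
      (BorelGame.one_lt_of_isSuccLimit hlim).le
    obtain ⟨m, hm⟩ := (BorelGame.isRegularStage hfin h1).exists_floor hξ
    obtain ⟨p, hp⟩ := hm.exists_steady h
    exact ⟨p, hm.mem_H hξ hp, hm.isMonotonicAt hp⟩
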